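/- **Setting.** Let $q(x_1,\dots,x_k)\,{:}{-}\,S_1(\mathbf y_1),\dots,S_l(\mathbf y_l)$ be a full conjunctive query without self-joins; atom $S_j$ has arity $r_j\ge 1$, the variables within one atom are distinct, and every variable occurs in some atom. A fractional edge packing of $q$ is a vector $\mathbf u=(u_1,\dots,u_l)$ with $u_j\ge 0$ and $\sum_{j:\,x_i\in S_j}u_j\le 1$ for every variable $x_i$. The domain is $[n]$ with $n\ge 2$, and relation $S_j$ has $m_j\ge 1$ tuples. Consider two input distributions: * $\mathcal I$: the uniform distribution on matching databases, i.e. databases with $|S_j|=m_j$ such that in every attribute of every $S_j$ each value of $[n]$ occurs at most once; here $m_j\le n$, and $m_j\le\theta n$ whenever $r_j=1$; * $\mathcal I^d$: the uniform distribution on $\theta$-dense databases, i.e. databases with $|S_j|=m_j=\theta n^{r_j}$ for all $j$. There are $p$ machines with linear costs $g_c(N)=N/w_c$, where $w_c\ge 0$ and at least one $w_c$ is positive (if $w_c=0$, the cost is $0$ for $N=0$ and $\infty$ otherwise). In a one-round algorithm each relation is initially stored at a separate location; the location of $S_j$ sends to each machine $c$ a bit string depending only on $S_j$ (and, for randomized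 algorithms, on a shared random seed independent of the input), after which machine $c$ outputs a set of tuples depending only on the strings it received (and the seed). The output of the algorithm is the union of the outputs of the machines, and it may contain only tuples of $q(I)$. If machine $c$ receives $N_c$ bits in total, the load is the maximum of $N_c/w_c$ over all machines, all inputs in the support of the distribution, and all seeds. **Theorem.** For every $\theta\in(0,1)$ there is a constant $\kappa>0$, depending only on $\theta$, such that the following holds for all $q$, $n$, $p$, $(m_j)$, $(w_c)$ as above and any choice of a fractional edge packing $\mathbf u_c=(u_{c,1},\dots,u_{c,l})$ of $q$ for each machine $c$. There is a smallest $L\ge 0$ with $$\sum_{c\in[p]}\prod_{j\in[l]}\left(\frac{L\,w_c}{m_j}\right)^{u_{c,j}}\ \ge\ 1 \qquad(\text{where } 0^0=1),$$ and every one-round algorithm that on inputs $I\sim\mathcal I$ outputs in expectation at least $\mathbb E_{I\sim\mathcal I}[|q(I)|]$ tuples has load at least $\kappa L$. The same holds with $\mathcal I^d$ in place of $\mathcal I$. -/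

import Mathlib

open scoped BigOperators ENNReal

universe u

/-- A full conjunctive query (natural join) without self-joins, with variables `x_i`, `i : Fin k`,
and atoms `S_j`, `j : Fin l`. The variables of one atom are pairwise distinct (there are no
selections), every atom has at least one variable, and every variable occurs in some atom. -/
structure ConjunctiveQuery (k l : ℕ) where
  /-- the arity `r_j` of `S_j` -/
  arity : Fin l → ℕ
  arity_pos : ∀ j, 0 < arity j
  /-- `var j a` is the variable at attribute `a` of the atom `S_j` -/
  var : ∀ j, Fin (arity j) → Fin k
  var_injective : ∀ j, Function.Injective (var j)
  var_covers : ∀ i, ∃ j a, var j a = i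

/-- A relation of arity `r` over a domain with `n` values. -/
abbrev Relation (n r : ℕ) : Type := Finset (Fin r → Fin n)

/-- A relation is a matching if every value occurs at most once in every attribute. -/
def Relation.IsMatching {n r : ℕ} (R : Relation n r) : Prop :=
  ∀ a : Fin r, ∀ s ∈ R, ∀ t ∈ R, s a = t a → s = t

namespace ConjunctiveQuery

variable {k l : ℕ}

/-- An instance: one relation for every atom. -/
abbrev Database (q : ConjunctiveQuery k l) (n : ℕ) : Type := ∀ j, Relation n (q.arity j)

/-- The output `q(I)`. -/
def eval (q : ConjunctiveQuery k l) {n : ℕ} (I : q.Database n) : Finset (Fin k → Fin n) :=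
  Finset.univ.filter fun a => ∀ j, (fun i => a (q.var j i)) ∈ I j

/-- Nonnegative weights on the atoms such that, for every variable, the atoms that contain it have
total weight at most one. -/
def IsFractionalEdgePacking (q : ConjunctiveQuery k l) (v : Fin l → ℝ) : Prop :=
  (∀ j, 0 ≤ v j) ∧
    ∀ i : Fin k, ∑ j ∈ Finset.univ.filter (fun j => ∃ a, q.var j a = i), v j ≤ 1

open Classical in
/-- All databases in which `S_j` has `m j` tuples. With `m j = θ * n ^ r_j` these are the
`θ`-dense databases. -/
noncomputable def instances (q : ConjunctiveQuery k l) (n : ℕ) (m : Fin l → ℕ) :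
    Finset (q.Database n) :=
  Finset.univ.filter fun I => ∀ j, (I j).card = m j

open Classical in
/-- All matching databases in which `S_j` has `m j` tuples. -/
noncomputable def matchingInstances (q : ConjunctiveQuery k l) (n : ℕ) (m : Fin l → ℕ) :
    Finset (q.Database n) :=
  Finset.univ.filter fun I => ∀ j, (I j).card = m j ∧ (I j).IsMatching

/-- The expected output size `E[|q(I)|]` for `I` uniform in the finite set `D`. -/
noncomputable def expectedSize (q : ConjunctiveQuery k l) {n : ℕ}
    (D : Finset (q.Database n)) : ℝ :=
  (∑ I ∈ D, ((q.eval I).card : ℝ)) / (D.card : ℝ)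

end ConjunctiveQuery

/-- A one-round algorithm on `p` machines. Every relation is initially stored at its own location.
In the communication phase the location of `S_j` sends to machine `c` a bit string that depends on
`S_j` only; in the computation phase machine `c` outputs a set of tuples that depends only on the
strings that it received. The random seed `ω : Ω`, shared by all the parties, makes randomized
algorithms a special case; deterministic algorithms are those that ignore it. There is no
restriction on local computation. -/
structure OneRoundAlgorithm {k l : ℕ} (q : ConjunctiveQuery k l) (n p : ℕ) (Ω : Type u) where
  msg : Ω → Fin p → ∀ j, Relation n (q.arity j) → List Bool
  out : Ω → Fin p → (Fin l → List Bool) → Finset (Fin k → Fin n)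

namespace OneRoundAlgorithm

variable {k l n p : ℕ} {q : ConjunctiveQuery k l} {Ω : Type u}

/-- The number `N_c` of bits that machine `c` receives on the input `I`. -/
def bitsReceived (A : OneRoundAlgorithm q n p Ω) (ω : Ω) (I : q.Database n) (c : Fin p) : ℕ :=
  ∑ j, (A.msg ω c j (I j)).length

/-- The output of the algorithm: the union of the outputs of all the machines. -/
def output (A : OneRoundAlgorithm q n p Ω) (ω : Ω) (I : q.Database n) :
    Finset (Fin k → Fin n) :=
  Finset.univ.biUnion fun c => A.out ω c fun j => A.msg ω c j (I j)

/-- On the inputs in `D` the algorithm outputs only tuples of `q(I)`. -/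
def IsSoundOn (A : OneRoundAlgorithm q n p Ω) (D : Finset (q.Database n)) : Prop :=
  ∀ ω, ∀ I ∈ D, A.output ω I ⊆ q.eval I

/-- The expected number of output tuples for `I` uniform in `D` and an independent seed with
law `P`. -/
noncomputable def expectedOutput [MeasurableSpace Ω] (A : OneRoundAlgorithm q n p Ω)
    (P : MeasureTheory.Measure Ω) (D : Finset (q.Database n)) : ℝ :=
  ∫ ω, (∑ I ∈ D, ((A.output ω I).card : ℝ)) / (D.card : ℝ) ∂P

/-- The load in the linear cost model: the maximal cost `N_c / w_c` over the machines, the inputs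
in `D` and the seeds (a machine of weight zero has cost `0` if it receives nothing and cost `∞`
otherwise). -/
noncomputable def load (A : OneRoundAlgorithm q n p Ω) (w : Fin p → ℝ)
    (D : Finset (q.Database n)) : ℝ≥0∞ :=
  ⨆ ω, ⨆ I ∈ D, ⨆ c, (A.bitsReceived ω I c : ℝ≥0∞) / ENNReal.ofReal (w c)

end OneRoundAlgorithm

/-- The numbers `L ≥ 0` with `∑_c ∏_j (L w_c / m_j) ^ u_{c,j} ≥ 1`, where `0 ^ 0 = 1`. -/
def admissibleLoads {l p : ℕ} (m : Fin l → ℕ) (w : Fin p → ℝ) (v : Fin p → Fin l → ℝ) : Set ℝ :=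
  {L | 0 ≤ L ∧ 1 ≤ ∑ c, ∏ j, (L * w c / (m j : ℝ)) ^ (v c j)}

/-- Every one-round algorithm on `p` machines with weights `w` that outputs only correct tuples and
that, for inputs uniform in `D`, outputs in expectation at least `E[|q(I)|]` tuples has load at
least `B`. -/
def OneRoundLoadAtLeast {k l n p : ℕ} (q : ConjunctiveQuery k l) (D : Finset (q.Database n))
    (w : Fin p → ℝ) (B : ℝ) : Prop :=
  ∀ (Ω : Type u) [MeasurableSpace Ω] (P : MeasureTheory.Measure Ω)
    [MeasureTheory.IsProbabilityMeasure P] (A : OneRoundAlgorithm q n p Ω),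
    A.IsSoundOn D → q.expectedSize D ≤ A.expectedOutput P D →
      ENNReal.ofReal B ≤ A.load w D

/-! Both distributions are products: the relations `S_j` are independent, each uniform in a family
`D j`. Fix the seed and a machine. Replacing `S_j` by another member of `D j` with the same message
does not change the output, so by soundness an output tuple must project, for every `j`, into the
set of elements that the message about `S_j` forces (`knownElements`). If `g j t` is the probability
that `t` is forced, the expected output of the machine is at most `∑ a, ∏ j, g j (a_j)`, where `a_j`
is the projection of `a`.

Two bounds control `g j`. Forced elements are present, so `g j ≤ d j`, the density `m j / n ^ r_j`.
And `N` bits force only `C * N` elements on average (`sum_card_knownElements_le`), because a given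
set `K` is contained in `S_j` with probability at most `ρ ^ |K|` and there are at most `4 ^ N`
messages. Interpolating, `g ≤ d ^ (1 - v) * g ^ v`; Friedgut's inequality for the packing `v`
(`expect_prod_rpow_le_of_packing`) then bounds the output by `E[|q(I)|] * ∏ j, (C * N / m j) ^ v j`.

With load `B`, machine `c` receives at most `B * w c` bits. Summing over machines gives `E[|q(I)|]`
times the sum defining `admissibleLoads` at `C * B`, which is below `1` when `C * B < L`. Hence `κ =
1 / C`. -/

/-! ### Friedgut's inequality for averages -/

/-- Hölder's inequality for averages with exponents of total at most one. -/
theorem expect_prod_rpow_le {ι α : Type*} [Fintype α] [Nonempty α] (s : Finset ι)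
    (h : ι → α → ℝ) (h0 : ∀ j a, 0 ≤ h j a) (v : ι → ℝ) (v0 : ∀ j, 0 ≤ v j)
    (hv : ∑ j ∈ s, v j ≤ 1) :
    Finset.expect Finset.univ (fun a => ∏ j ∈ s, h j a ^ v j) ≤
      ∏ j ∈ s, (Finset.expect Finset.univ (h j)) ^ v j := by
  set H : ι → ℝ := fun j => Finset.expect Finset.univ (h j) with hH
  have H0 : ∀ j, 0 ≤ H j := fun j => Finset.expect_nonneg fun a _ => h0 j a
  have hzero : ∀ j, H j = 0 → ∀ a, h j a = 0 := fun j hj a =>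
    (Finset.expect_eq_zero_iff_of_nonneg fun a _ => h0 j a).1 hj a (Finset.mem_univ a)
  -- Normalise each factor to mean one. If the mean is `0` the factor vanishes identically, and the
  -- convention `x / 0 = 0` keeps the identity true, including for `v j = 0`.
  have hfac : ∀ j a, h j a ^ v j = H j ^ v j * (h j a / H j) ^ v j := by
    intro j a
    rcases (H0 j).eq_or_lt with hj | hj
    · rw [hzero j hj.symm a, ← hj, zero_div]
      rcases (v0 j).eq_or_lt with h' | h'
      · simp [← h']
      · simp [Real.zero_rpow h'.ne']
    · rw [← Real.mul_rpow hj.le (div_nonneg (h0 j a) hj.le), mul_div_cancel₀ _ hj.ne']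
  have hamgm : ∀ a, ∏ j ∈ s, (h j a / H j) ^ v j ≤
      (1 - ∑ j ∈ s, v j) + ∑ j ∈ s, v j * (h j a / H j) := by
    intro a
    -- The extra index `none` carries the missing weight `1 - ∑ v j` with value `1`; this is why
    -- total weight at most one suffices.
    have := Real.geom_mean_le_arith_mean_weighted (Finset.insertNone s)
      (fun o => o.elim (1 - ∑ j ∈ s, v j) v) (fun o => o.elim 1 fun j => h j a / H j)
      (by rintro (_ | j) _ <;> simp [v0, hv]) (by simp)
      (by rintro (_ | j) _ <;> simp [div_nonneg, h0, H0])
    simpa using this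
  calc Finset.expect Finset.univ (fun a => ∏ j ∈ s, h j a ^ v j)
      = (∏ j ∈ s, H j ^ v j) * Finset.expect Finset.univ
          (fun a => ∏ j ∈ s, (h j a / H j) ^ v j) := by
        rw [Finset.mul_expect]
        exact Finset.expect_congr rfl fun a _ => by
          rw [← Finset.prod_mul_distrib]; exact Finset.prod_congr rfl fun j _ => hfac j a
    _ ≤ (∏ j ∈ s, H j ^ v j) * 1 := by
        refine mul_le_mul_of_nonneg_left ?_
          (Finset.prod_nonneg fun j _ => Real.rpow_nonneg (H0 j) _)
        refine (Finset.expect_le_expect fun a _ => hamgm a).trans ?_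
        rw [Finset.expect_add_distrib, Finset.expect_const Finset.univ_nonempty,
          Finset.expect_sum_comm]
        have : ∀ j ∈ s, Finset.expect Finset.univ (fun a => v j * (h j a / H j)) ≤ v j := by
          intro j _
          rw [← Finset.mul_expect, ← Finset.expect_div]
          exact mul_le_of_le_one_right (v0 j) (div_self_le_one (H j))
        linarith [Finset.sum_le_sum this]
    _ = _ := mul_one _

theorem expect_fin_succ {α : Type*} [Fintype α] (k : ℕ) (F : (Fin (k + 1) → α) → ℝ) :
    Finset.expect Finset.univ F = Finset.expect Finset.univ (fun b : Fin k → α =>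
      Finset.expect Finset.univ fun x : α => F (Fin.cons x b)) := by
  rw [Finset.expect_comm, ← Finset.expect_product', Finset.univ_product_univ]
  exact (Fintype.expect_equiv (Fin.consEquiv fun _ => α) _ _ fun x => rfl).symm

/-- Friedgut's inequality for fractional edge packings: the average of a product of powers is at
most the product of the powers of the averages. -/
theorem expect_prod_rpow_le_of_packing {ι α : Type*} [Fintype ι] [Fintype α] [Nonempty α]
    (v : ι → ℝ) (v0 : ∀ j, 0 ≤ v j) (k : ℕ) :
    ∀ (h : ι → (Fin k → α) → ℝ) (A : ι → Set (Fin k)) [∀ i, DecidablePred fun j => i ∈ A j],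
      (∀ j a, 0 ≤ h j a) → (∀ j, DependsOn (h j) (A j)) →
      (∀ i, ∑ j ∈ Finset.univ.filter (fun j => i ∈ A j), v j ≤ 1) →
      Finset.expect Finset.univ (fun a => ∏ j, h j a ^ v j) ≤
        ∏ j, (Finset.expect Finset.univ (h j)) ^ v j := by
  induction k with
  | zero =>
    intro h A _ h0 _ _
    simp [Finset.univ_unique]
  | succ k ih =>
    intro h A _ h0 hdep hv
    set h' : ι → (Fin k → α) → ℝ :=
      fun j b => Finset.expect Finset.univ fun x : α => h j (Fin.cons x b) with hh'
    -- Factors that do not depend on coordinate `0` leave the average over it; the others have total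
    -- weight at most one, so Hölder applies.
    have key : ∀ b : Fin k → α, Finset.expect Finset.univ
        (fun x : α => ∏ j, h j (Fin.cons x b) ^ v j) ≤ ∏ j, h' j b ^ v j := by
      intro b
      have hconst : ∀ j, 0 ∉ A j → ∀ x : α, h j (Fin.cons x b) = h' j b := by
        intro j hj x
        have : ∀ y : α, h j (Fin.cons y b) = h j (Fin.cons x b) := fun y =>
          hdep j fun i hi => by
            induction i using Fin.cases with
            | zero => exact absurd hi hj
            | succ i => simp
        simp only [hh', this, Finset.expect_const Finset.univ_nonempty]
      have hsplit : ∀ g : ι → ℝ, ∏ j, g j =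
          (∏ j ∈ Finset.univ.filter (fun j => ¬ 0 ∈ A j), g j) *
            ∏ j ∈ Finset.univ.filter (fun j => 0 ∈ A j), g j := fun g => by
        rw [mul_comm, Finset.prod_filter_mul_prod_filter_not]
      rw [hsplit]
      calc _ = Finset.expect Finset.univ (fun x : α =>
            (∏ j ∈ Finset.univ.filter (fun j => ¬ 0 ∈ A j), h' j b ^ v j) *
            ∏ j ∈ Finset.univ.filter (fun j => 0 ∈ A j), h j (Fin.cons x b) ^ v j) := by
            refine Finset.expect_congr rfl fun x _ => ?_
            rw [hsplit]
            congr 1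
            refine Finset.prod_congr rfl fun j hj => ?_
            rw [hconst j (Finset.mem_filter.1 hj).2]
        _ ≤ _ := by
            rw [← Finset.mul_expect]
            refine mul_le_mul_of_nonneg_left ?_ (Finset.prod_nonneg fun j _ =>
              Real.rpow_nonneg (Finset.expect_nonneg fun x _ => h0 j _) _)
            exact expect_prod_rpow_le _ (fun j x => h j (Fin.cons x b)) (fun j x => h0 j _) v v0
              (hv 0)
    rw [expect_fin_succ]
    refine (Finset.expect_le_expect fun b _ => key b).trans ?_
    refine (ih h' (fun j => {i | i.succ ∈ A j}) (fun j b => Finset.expect_nonneg fun x _ => h0 j _)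
      ?_ fun i => hv i.succ).trans_eq ?_
    · intro j a b hab
      refine Finset.expect_congr rfl fun x _ => hdep j fun i hi => ?_
      induction i using Fin.cases with
      | zero => simp
      | succ i => simpa using hab i hi
    · exact Finset.prod_congr rfl fun j _ => by rw [expect_fin_succ]

/-- Restricting a uniformly random assignment to some of its coordinates gives a uniformly random
assignment. -/
theorem expect_comp_injective {ι κ α : Type*} [Fintype ι] [Fintype κ] [DecidableEq ι]
    [DecidableEq κ] [Fintype α] [Nonempty α] (σ : ι → κ) (hσ : Function.Injective σ)
    (f : (ι → α) → ℝ) :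
    Finset.expect Finset.univ (fun a : κ → α => f fun i => a (σ i)) =
      Finset.expect Finset.univ f := by
  classical
  let e : ι ⊕ ((Set.range σ)ᶜ : Set κ) ≃ κ :=
    (Equiv.sumCongr (Equiv.ofInjective σ hσ) (Equiv.refl _)).trans (Equiv.Set.sumCompl _)
  let E : (κ → α) ≃ (ι → α) × (((Set.range σ)ᶜ : Set κ) → α) :=
    (Equiv.arrowCongr e.symm (Equiv.refl α)).trans (Equiv.sumArrowEquivProdArrow _ _ _)
  rw [Fintype.expect_equiv E _ (fun x => f x.1) fun a => ?_, ← Finset.univ_product_univ,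
    Finset.expect_product]
  · simp [Finset.expect_const Finset.univ_nonempty]
  · rfl

/-! ### What a short message reveals -/

/-- There are `2 ^ (N + 1) - 1` strings of length at most `N`. The cruder `4 ^ N` is still exact at
`N = 0`, so its logarithm is linear in `N` without an additive term. -/
theorem card_image_length_le {β : Type*} (D : Finset β) (msg : β → List Bool) (N : ℕ)
    (hN : ∀ S ∈ D, (msg S).length ≤ N) : (D.image msg).card ≤ 4 ^ N := by
  have hsub : D.image msg ⊆ (Finset.range (N + 1)).biUnion fun i =>
      (Finset.univ : Finset (Fin i → Bool)).image List.ofFn := by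
    intro x hx
    obtain ⟨S, hS, rfl⟩ := Finset.mem_image.1 hx
    refine Finset.mem_biUnion.2 ⟨(msg S).length, Finset.mem_range.2 (Nat.lt_succ_of_le (hN S hS)),
      Finset.mem_image.2 ⟨(msg S).get, Finset.mem_univ _, List.ofFn_get _⟩⟩
  refine (Finset.card_le_card hsub).trans (Finset.card_biUnion_le.trans ?_)
  refine (Finset.sum_le_sum fun i _ => Finset.card_image_le).trans ?_
  simp only [Finset.card_univ, Fintype.card_fun, Fintype.card_bool, Fintype.card_fin]
  clear hsub hN
  induction N with
  | zero => simp
  | succ N ih =>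
    rw [Finset.sum_range_succ]
    have h1 : 2 ^ N ≤ 4 ^ N := Nat.pow_le_pow_left (by norm_num) N
    have h2 : 2 ^ (N + 1) = 2 * 2 ^ N := by ring
    have h3 : 4 ^ (N + 1) = 4 * 4 ^ N := by ring
    have h4 : 1 ≤ 4 ^ N := Nat.one_le_pow _ _ (by norm_num)
    omega

/-- The elements that the message sent for `S` forces to be in the set. -/
def knownElements {α : Type*} [Fintype α] [DecidableEq α] (D : Finset (Finset α))
    (msg : Finset α → List Bool) (S : Finset α) : Finset α :=
  Finset.univ.filter fun t => ∀ S' ∈ D, msg S' = msg S → t ∈ S'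

/-- A message of `N` bits about a random set reveals `O(N)` elements on average, if any `k`
elements are in the set with probability at most `ρ ^ k`. -/
theorem sum_card_knownElements_le {α : Type*} [Fintype α] [DecidableEq α]
    (D : Finset (Finset α)) (hD : D.Nonempty) (ρ : ℝ) (hρ₀ : 0 < ρ) (hρ₁ : ρ < 1)
    (hρ : ∀ K : Finset α, ((D.filter fun S => K ⊆ S).card : ℝ) ≤ ρ ^ K.card * D.card)
    (msg : Finset α → List Bool) (N : ℕ) (hN : ∀ S ∈ D, (msg S).length ≤ N) :
    (∑ S ∈ D, ((knownElements D msg S).card : ℝ)) / D.card ≤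
      (Real.log 4 / -Real.log ρ) * N := by
  have hlam : 0 < -Real.log ρ := neg_pos.2 (Real.log_neg hρ₀ hρ₁)
  have hDpos : (0 : ℝ) < D.card := by exact_mod_cast hD.card_pos
  -- All sets with one message share one forced set `K` and contain it, so there are at most `ρ ^
  -- |K| * |D|` of them; this cancels the weight `ρ ^ (-|K|)`.
  have hfib : ∀ σ ∈ D.image msg, ∑ S ∈ D with msg S = σ,
      Real.exp (-Real.log ρ * (knownElements D msg S).card) ≤ D.card := by
    intro σ hσ
    obtain ⟨S₀, hS₀, rfl⟩ := Finset.mem_image.1 hσ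
    have hconst : ∀ S ∈ D.filter (fun S => msg S = msg S₀),
        Real.exp (-Real.log ρ * (knownElements D msg S).card) =
          Real.exp (-Real.log ρ * (knownElements D msg S₀).card) := by
      intro S hS
      rw [knownElements, (Finset.mem_filter.1 hS).2, ← knownElements]
    rw [Finset.sum_congr rfl hconst, Finset.sum_const, nsmul_eq_mul]
    have hle : (D.filter fun S => msg S = msg S₀).card ≤
        (D.filter fun S => knownElements D msg S₀ ⊆ S).card := by
      refine Finset.card_le_card fun S hS => ?_
      obtain ⟨hS, hm⟩ := Finset.mem_filter.1 hS
      exact Finset.mem_filter.2 ⟨hS, fun t ht => (Finset.mem_filter.1 ht).2 S hS hm⟩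
    have hle' := (Nat.cast_le (α := ℝ).2 hle).trans (hρ (knownElements D msg S₀))
    have hexp : Real.exp (-Real.log ρ * (knownElements D msg S₀).card) =
        (ρ ^ (knownElements D msg S₀).card)⁻¹ := by
      rw [neg_mul, Real.exp_neg, mul_comm, Real.exp_nat_mul, Real.exp_log hρ₀]
    rw [hexp, ← div_eq_mul_inv, div_le_iff₀ (by positivity), mul_comm]
    exact hle'
  have hsum : ∑ S ∈ D, Real.exp (-Real.log ρ * (knownElements D msg S).card) ≤
      4 ^ N * D.card := by
    rw [← Finset.sum_fiberwise_of_maps_to (fun S hS => Finset.mem_image_of_mem msg hS)]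
    refine (Finset.sum_le_sum hfib).trans ?_
    rw [Finset.sum_const, nsmul_eq_mul]
    gcongr
    exact_mod_cast card_image_length_le D msg N hN
  -- Jensen turns the exponential moment bound `4 ^ N` into a bound on the mean.
  have hjensen := convexOn_exp.map_sum_le (t := D) (w := fun _ => (D.card : ℝ)⁻¹)
    (p := fun S => -Real.log ρ * (knownElements D msg S).card)
    (fun _ _ => by positivity) (by simp [hDpos.ne']) (fun _ _ => Set.mem_univ _)
  simp only [smul_eq_mul, ← Finset.mul_sum] at hjensen
  have h4 : Real.exp ((D.card : ℝ)⁻¹ * (-Real.log ρ *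
      ∑ S ∈ D, ((knownElements D msg S).card : ℝ))) ≤ 4 ^ N := by
    refine hjensen.trans ?_
    rw [inv_mul_le_iff₀ hDpos, mul_comm]
    exact hsum
  rw [← Real.le_log_iff_exp_le (by positivity), Real.log_pow] at h4
  rw [div_mul_eq_mul_div, le_div_iff₀ hlam]
  calc _ = (D.card : ℝ)⁻¹ * (-Real.log ρ * ∑ S ∈ D, ((knownElements D msg S).card : ℝ)) := by
        ring
    _ ≤ _ := by linarith

/-! ### Containment probabilities by symmetry -/

/-- Double counting for a family of `m`-sets that is symmetric over the elements of `T`. -/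
theorem card_mul_card_filter_insert_subset {α : Type*} [DecidableEq α]
    (D : Finset (Finset α)) (m : ℕ) (hm : ∀ S ∈ D, S.card = m) (K T : Finset α)
    (hTK : Disjoint T K) (hT : ∀ S ∈ D, K ⊆ S → S \ K ⊆ T)
    (hsymm : ∀ t ∈ T, ∀ t' ∈ T, (D.filter fun S => insert t K ⊆ S).card ≤
      (D.filter fun S => insert t' K ⊆ S).card) (t : α) (ht : t ∈ T) :
    T.card * (D.filter fun S => insert t K ⊆ S).card =
      (m - K.card) * (D.filter fun S => K ⊆ S).card := by
  have h1 : ∑ t' ∈ T, (D.filter fun S => insert t' K ⊆ S).card =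
      T.card * (D.filter fun S => insert t K ⊆ S).card :=
    Finset.sum_const_nat fun t' ht' => le_antisymm (hsymm t' ht' t ht) (hsymm t ht t' ht')
  have h2 : ∀ t' ∈ T, (D.filter fun S => insert t' K ⊆ S) =
      ((D.filter fun S => K ⊆ S).filter fun S => t' ∈ S) := by
    intro t' _
    ext S
    simp only [Finset.mem_filter, Finset.insert_subset_iff]
    tauto
  rw [← h1, Finset.sum_congr rfl fun t' ht' => by rw [h2 t' ht']]
  -- Count pairs `t' ∈ S` with `K ⊆ S`: each such `S` has exactly `m - |K|` elements in `T`.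
  have h3 := Finset.sum_card_bipartiteAbove_eq_sum_card_bipartiteBelow
    (s := T) (t := D.filter fun S => K ⊆ S) (r := fun t' S => t' ∈ S)
  simp only [Finset.bipartiteAbove, Finset.bipartiteBelow] at h3
  rw [h3, Finset.sum_const_nat (m := m - K.card), mul_comm]
  intro S hS
  obtain ⟨hS, hKS⟩ := Finset.mem_filter.1 hS
  have : T.filter (fun t' => t' ∈ S) = S \ K := by
    ext x
    simp only [Finset.mem_filter, Finset.mem_sdiff]
    exact ⟨fun h => ⟨h.2, Finset.disjoint_left.1 hTK h.1⟩,
      fun h => ⟨hT S hS hKS (Finset.mem_sdiff.2 h), h.1⟩⟩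
  rw [this, Finset.card_sdiff_of_subset hKS, hm S hS]

theorem card_filter_insert_subset_le {α : Type*} [DecidableEq α] (D : Finset (Finset α))
    (e : Equiv.Perm α) (he : ∀ S ∈ D, S.map e.toEmbedding ∈ D) (K : Finset α)
    (hK : ∀ x ∈ K, e x = x) (t t' : α) (ht : e t = t') :
    (D.filter fun S => insert t K ⊆ S).card ≤ (D.filter fun S => insert t' K ⊆ S).card := by
  refine Finset.card_le_card_of_injOn (fun S => S.map e.toEmbedding) ?_
    (Finset.map_injective _).injOn
  intro S hS
  obtain ⟨hS, hK'⟩ := Finset.mem_filter.1 hS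
  refine Finset.mem_filter.2 ⟨he S hS, fun x hx => ?_⟩
  rcases Finset.mem_insert.1 hx with rfl | hx
  · exact Finset.mem_map.2 ⟨t, hK' (Finset.mem_insert_self _ _), ht⟩
  · exact Finset.mem_map.2 ⟨x, hK' (Finset.mem_insert_of_mem hx), hK x hx⟩

/-- Conditioning on `k` present elements does not raise the density: `m - k ≤ θ * N - k ≤ θ * (N -
k)`. If `k > m`, the truncated difference is `0`. -/
theorem sub_le_mul_sub {m k N : ℕ} {θ : ℝ} (hθ₀ : 0 ≤ θ) (hθ₁ : θ ≤ 1) (hm : (m : ℝ) ≤ θ * N)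
    (hk : k ≤ N) : ((m - k : ℕ) : ℝ) ≤ θ * ((N - k : ℕ) : ℝ) := by
  rw [Nat.cast_sub hk]
  have hk' : (k : ℝ) ≤ N := by exact_mod_cast hk
  rcases le_total k m with h | h
  · rw [Nat.cast_sub h]
    nlinarith [(Nat.cast_nonneg k : (0 : ℝ) ≤ k)]
  · rw [Nat.sub_eq_zero_of_le h, Nat.cast_zero]
    exact mul_nonneg hθ₀ (sub_nonneg.2 hk')

/-! ### All sets of a given size -/

theorem card_mul_card_filter_insert_subset_powersetCard {α : Type*} [Fintype α] [DecidableEq α]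
    (m : ℕ) (K : Finset α) (t : α) (ht : t ∉ K) :
    (Fintype.card α - K.card) *
        ((Finset.univ.powersetCard m).filter fun S => insert t K ⊆ S).card =
      (m - K.card) * ((Finset.univ.powersetCard m).filter fun S : Finset α => K ⊆ S).card := by
  have := card_mul_card_filter_insert_subset (Finset.univ.powersetCard m) m
    (fun S hS => (Finset.mem_powersetCard.1 hS).2) K Kᶜ disjoint_compl_left
    (fun S _ _ x hx => Finset.mem_compl.2 (Finset.mem_sdiff.1 hx).2)
    (fun t ht t' ht' => card_filter_insert_subset_le _ (Equiv.swap t t')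
      (fun S hS => by simpa using hS) K
      (fun x hx => Equiv.swap_apply_of_ne_of_ne (fun h => Finset.mem_compl.1 ht (h ▸ hx))
        fun h => Finset.mem_compl.1 ht' (h ▸ hx)) _ _ (Equiv.swap_apply_left _ _))
    t (Finset.mem_compl.2 ht)
  rwa [Finset.card_compl] at this

/-- Reveal `K` one element at a time: given the earlier ones, the next is present with probability
`(m - i) / (N - i) ≤ θ`. -/
theorem card_filter_subset_powersetCard_le {α : Type*} [Fintype α] [DecidableEq α]
    (m : ℕ) (θ : ℝ) (hθ₀ : 0 ≤ θ) (hθ₁ : θ ≤ 1) (hm : (m : ℝ) ≤ θ * Fintype.card α)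
    (K : Finset α) :
    (((Finset.univ.powersetCard m).filter fun S => K ⊆ S).card : ℝ) ≤
      θ ^ K.card * (Finset.univ.powersetCard m : Finset (Finset α)).card := by
  induction K using Finset.induction_on with
  | empty => simp
  | insert t K ht ih =>
    have h := card_mul_card_filter_insert_subset_powersetCard m K t ht
    have hlt : K.card < Fintype.card α := Finset.card_lt_univ_of_notMem ht
    have hpos : (0 : ℝ) < ((Fintype.card α - K.card : ℕ) : ℝ) := by
      exact_mod_cast Nat.sub_pos_of_lt hlt
    have hr := congrArg (Nat.cast : ℕ → ℝ) h
    rw [Nat.cast_mul, Nat.cast_mul] at hr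
    rw [Finset.card_insert_of_notMem ht, pow_succ]
    refine le_of_mul_le_mul_left ?_ hpos
    rw [hr]
    calc _ ≤ (θ * ((Fintype.card α - K.card : ℕ) : ℝ)) * _ :=
          mul_le_mul (sub_le_mul_sub hθ₀ hθ₁ hm hlt.le) ih (by positivity) (by positivity)
      _ = _ := by ring

/-! ### Matchings -/

open Classical in
/-- The matchings with `m` tuples. -/
noncomputable def matchings (n r m : ℕ) : Finset (Relation n r) :=
  Finset.univ.filter fun R => R.card = m ∧ R.IsMatching

theorem mem_matchings {n r m : ℕ} {R : Relation n r} :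
    R ∈ matchings n r m ↔ R.card = m ∧ R.IsMatching := by
  simp [matchings]

theorem matchings_nonempty {n r m : ℕ} (hr : 0 < r) (hm : m ≤ n) : (matchings n r m).Nonempty := by
  refine ⟨Finset.univ.map ⟨fun i : Fin m => fun _ => Fin.castLE hm i, fun i j h => ?_⟩,
    mem_matchings.2 ⟨by simp, ?_⟩⟩
  · exact Fin.castLE_injective hm (congrFun h ⟨0, hr⟩)
  · intro a s hs t ht h
    obtain ⟨i, -, rfl⟩ := Finset.mem_map.1 hs
    obtain ⟨j, -, rfl⟩ := Finset.mem_map.1 ht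
    have hij : i = j := Fin.castLE_injective hm h
    rw [hij]

theorem Relation.IsMatching.mono {n r : ℕ} {R S : Relation n r} (hS : S.IsMatching)
    (h : R ⊆ S) : R.IsMatching :=
  fun a s hs t ht => hS a s (h hs) t (h ht)

theorem map_piCongrRight_mem_matchings {n r m : ℕ} {R : Relation n r} (hR : R ∈ matchings n r m)
    (e : Fin r → Equiv.Perm (Fin n)) :
    R.map (Equiv.piCongrRight e).toEmbedding ∈ matchings n r m := by
  obtain ⟨hc, hR⟩ := mem_matchings.1 hR
  refine mem_matchings.2 ⟨by rw [Finset.card_map, hc], ?_⟩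
  intro a s hs t ht h
  obtain ⟨s', hs', rfl⟩ := Finset.mem_map.1 hs
  obtain ⟨t', ht', rfl⟩ := Finset.mem_map.1 ht
  rw [hR a s' hs' t' ht' ((e a).injective h)]

theorem pow_mul_card_filter_insert_subset_matchings {n r : ℕ} (hr : 0 < r) (m : ℕ)
    (K : Relation n r) (hK : K.IsMatching) (t : Fin r → Fin n)
    (ht : ∀ s ∈ K, ∀ a, t a ≠ s a) :
    (n - K.card) ^ r * ((matchings n r m).filter fun S => insert t K ⊆ S).card =
      (m - K.card) * ((matchings n r m).filter fun S => K ⊆ S).card := by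
  -- The tuples that avoid, in every attribute, the values used by `K`. Independent permutations of
  -- the values in each attribute act transitively on `T` and can be chosen to fix `K`.
  set T : Finset (Fin r → Fin n) := Fintype.piFinset fun a => (K.image fun s => s a)ᶜ with hT
  have hmem : ∀ t, t ∈ T ↔ ∀ s ∈ K, ∀ a, t a ≠ s a := by
    intro t
    simp only [hT, Fintype.mem_piFinset, Finset.mem_compl, Finset.mem_image, not_exists, not_and]
    exact ⟨fun h s hs a e => h a s hs e.symm, fun h a s hs e => h s hs a e.symm⟩
  have hcard : T.card = (n - K.card) ^ r := by
    rw [hT, Fintype.card_piFinset, Finset.prod_congr rfl (g := fun _ => n - K.card)]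
    · simp
    · intro a _
      rw [Finset.card_compl, Fintype.card_fin,
        Finset.card_image_of_injOn fun s hs t ht h => hK a s hs t ht h]
  have := card_mul_card_filter_insert_subset (matchings n r m) m
    (fun S hS => (mem_matchings.1 hS).1) K T
    (Finset.disjoint_left.2 fun s hs hs' => (hmem s).1 hs s hs' ⟨0, hr⟩ rfl)
    (fun S hS hKS x hx => (hmem x).2 fun s hs a h =>
      (Finset.mem_sdiff.1 hx).2 ((mem_matchings.1 hS).2 a x (Finset.mem_sdiff.1 hx).1 s
        (hKS hs) h ▸ hs))
    (fun t ht t' ht' => card_filter_insert_subset_le _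
      (Equiv.piCongrRight fun a => Equiv.swap (t a) (t' a))
      (fun S hS => map_piCongrRight_mem_matchings hS _) K
      (fun x hx => funext fun a => Equiv.swap_apply_of_ne_of_ne
        ((hmem t).1 ht x hx a).symm ((hmem t').1 ht' x hx a).symm) _ _
      (funext fun a => Equiv.swap_apply_left _ _))
    t ((hmem t).2 ht)
  rwa [hcard] at this

theorem card_filter_subset_matchings_eq_zero {n r m : ℕ} {K : Relation n r}
    (hK : ¬ K.IsMatching) : ((matchings n r m).filter fun S => K ⊆ S).card = 0 := by
  rw [Finset.card_eq_zero, Finset.filter_eq_empty_iff]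
  exact fun S hS h => hK ((mem_matchings.1 hS).2.mono h)

theorem Relation.IsMatching.ne_of_insert {n r : ℕ} {K : Relation n r} {t : Fin r → Fin n}
    (h : Relation.IsMatching (insert t K)) (ht : t ∉ K) : ∀ s ∈ K, ∀ a, t a ≠ s a :=
  fun s hs a e => ht (h a t (Finset.mem_insert_self _ _) s (Finset.mem_insert_of_mem hs) e ▸ hs)

theorem Relation.IsMatching.card_le {n r : ℕ} (hr : 0 < r) {K : Relation n r}
    (h : K.IsMatching) : K.card ≤ n := by
  have := Finset.card_le_card_of_injOn (s := K) (t := (Finset.univ : Finset (Fin n)))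
    (fun s => s ⟨0, hr⟩) (fun _ _ => Finset.mem_univ _) fun s hs t ht e => h _ s hs t ht e
  simpa using this

theorem card_filter_subset_matchings_le_of_arity_one {n m : ℕ} (θ : ℝ) (hθ₀ : 0 ≤ θ)
    (hθ₁ : θ ≤ 1) (hm : (m : ℝ) ≤ θ * n) (K : Relation n 1) :
    (((matchings n 1 m).filter fun S => K ⊆ S).card : ℝ) ≤
      θ ^ K.card * (matchings n 1 m).card := by
  induction K using Finset.induction_on with
  | empty => simp
  | insert t K ht ih =>
    by_cases hK : Relation.IsMatching (insert t K)
    swap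
    · rw [card_filter_subset_matchings_eq_zero hK, Nat.cast_zero]
      positivity
    have h := pow_mul_card_filter_insert_subset_matchings one_pos m K
      (hK.mono (Finset.subset_insert _ _)) t (hK.ne_of_insert ht)
    have hlt := hK.card_le one_pos
    rw [Finset.card_insert_of_notMem ht] at hlt ⊢
    have hpos : (0 : ℝ) < ((n - K.card : ℕ) : ℝ) := by exact_mod_cast Nat.sub_pos_of_lt hlt
    have hr := congrArg (Nat.cast : ℕ → ℝ) h
    rw [pow_one, Nat.cast_mul, Nat.cast_mul] at hr
    rw [pow_succ]
    refine le_of_mul_le_mul_left ?_ hpos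
    rw [hr]
    calc _ ≤ (θ * ((n - K.card : ℕ) : ℝ)) * _ :=
          mul_le_mul (sub_le_mul_sub hθ₀ hθ₁ hm (Nat.le_of_lt hlt)) ih (by positivity)
            (by positivity)
      _ = _ := by ring

/-- After `i` tuples, the next has conditional probability `(m - i) / (n - i) ^ r ≤ 1 / (n - i)`,
since `r ≥ 2`. This is at most `1 / 2` unless `i = n - 1`: the last tuple of a perfect matching may
be forced, hence the cap `n - 1`. -/
theorem two_pow_mul_card_filter_subset_matchings_le {n r m : ℕ} (hr : 2 ≤ r) (hm : m ≤ n)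
    (K : Relation n r) :
    2 ^ (min K.card (n - 1)) * ((matchings n r m).filter fun S => K ⊆ S).card ≤
      (matchings n r m).card := by
  induction K using Finset.induction_on with
  | empty => simp
  | insert t K ht ih =>
    by_cases hK : Relation.IsMatching (insert t K)
    swap
    · rw [card_filter_subset_matchings_eq_zero hK, mul_zero]
      exact Nat.zero_le _
    have h := pow_mul_card_filter_insert_subset_matchings (by omega) m K
      (hK.mono (Finset.subset_insert _ _)) t (hK.ne_of_insert ht)
    have hlt := hK.card_le (by omega)
    rw [Finset.card_insert_of_notMem ht] at hlt ⊢
    set f := ((matchings n r m).filter fun S => K ⊆ S).card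
    set f' := ((matchings n r m).filter fun S => insert t K ⊆ S).card
    have hpos : 0 < n - K.card := by omega
    have hstep : (n - K.card) * f' ≤ f := by
      refine Nat.le_of_mul_le_mul_left ?_ hpos
      calc (n - K.card) * ((n - K.card) * f') = (n - K.card) ^ 2 * f' := by ring
        _ ≤ (n - K.card) ^ r * f' := by gcongr
        _ = (m - K.card) * f := h
        _ ≤ (n - K.card) * f := by gcongr
    refine le_trans ?_ ih
    by_cases hc : K.card + 1 ≤ n - 1
    · rw [min_eq_left hc, min_eq_left (by omega), pow_succ, mul_assoc]
      refine Nat.mul_le_mul_left _ (le_trans ?_ hstep)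
      exact Nat.mul_le_mul_right _ (by omega)
    · rw [min_eq_right (by omega), min_eq_right (by omega)]
      exact Nat.mul_le_mul_left _ (le_trans (Nat.le_mul_of_pos_left _ hpos) hstep)

/-- Base `3 / 4` instead of `1 / 2` absorbs the lost factor: when `k = n ≥ 2`, two tuples share one
factor `2`, and `(3 / 4) ^ 2 * 2 = 9 / 8`. -/
theorem one_le_three_quarters_pow_mul {n k : ℕ} (hn : 2 ≤ n) (hk : k ≤ n) :
    (1 : ℝ) ≤ (3 / 4) ^ k * 2 ^ (min k (n - 1)) := by
  have aux : ∀ i : ℕ, (1 : ℝ) ≤ (3 / 4) ^ i * 2 ^ i := fun i => by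
    rw [← mul_pow]; exact one_le_pow₀ (by norm_num)
  rcases Nat.lt_or_ge k n with h | h
  · rw [min_eq_left (by omega)]; exact aux k
  · obtain rfl : k = n := le_antisymm hk h
    obtain ⟨i, rfl⟩ := Nat.exists_eq_add_of_le hn
    rw [min_eq_right (by omega), show 2 + i - 1 = i + 1 by omega]
    calc (1 : ℝ) ≤ (3 / 4) ^ i * 2 ^ i := aux i
      _ ≤ (9 / 8) * ((3 / 4) ^ i * 2 ^ i) := le_mul_of_one_le_left (by positivity) (by norm_num)
      _ = _ := by ring

theorem card_filter_subset_matchings_le {n r m : ℕ} (hn : 2 ≤ n) (hr : 2 ≤ r) (hm : m ≤ n)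
    (K : Relation n r) :
    (((matchings n r m).filter fun S => K ⊆ S).card : ℝ) ≤
      (3 / 4) ^ K.card * (matchings n r m).card := by
  by_cases hK : K.IsMatching
  swap
  · rw [card_filter_subset_matchings_eq_zero hK, Nat.cast_zero]
    positivity
  have h := two_pow_mul_card_filter_subset_matchings_le hr hm K
  have h' : (2 : ℝ) ^ (min K.card (n - 1)) *
      (((matchings n r m).filter fun S => K ⊆ S).card : ℝ) ≤ (matchings n r m).card := by
    exact_mod_cast h
  calc _ ≤ ((3 / 4 : ℝ) ^ K.card * 2 ^ (min K.card (n - 1))) * _ :=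
        le_mul_of_one_le_left (by positivity)
          (one_le_three_quarters_pow_mul hn (hK.card_le (by omega)))
    _ = (3 / 4 : ℝ) ^ K.card * (2 ^ (min K.card (n - 1)) * _) := by ring
    _ ≤ _ := by gcongr

/-! ### One machine -/

namespace ConjunctiveQuery

variable {k l n : ℕ}

/-- Linearity of expectation and independence: for a fixed assignment the conditions concern
separate relations, so the count factorises. -/
theorem sum_card_filter_piFinset (q : ConjunctiveQuery k l)
    (D : ∀ j, Finset (Relation n (q.arity j)))
    (T : ∀ j, (Fin (q.arity j) → Fin n) → Relation n (q.arity j) → Prop)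
    [∀ j t, DecidablePred (T j t)] :
    ∑ I ∈ Fintype.piFinset D, (Finset.univ.filter fun a : Fin k → Fin n =>
        ∀ j, T j (fun i => a (q.var j i)) (I j)).card =
      ∑ a : Fin k → Fin n, ∏ j, ((D j).filter fun S => T j (fun i => a (q.var j i)) S).card := by
  have h := Finset.sum_card_bipartiteAbove_eq_sum_card_bipartiteBelow
    (s := Fintype.piFinset D) (t := (Finset.univ : Finset (Fin k → Fin n)))
    (r := fun I a => ∀ j, T j (fun i => a (q.var j i)) (I j))
  simp only [Finset.bipartiteAbove, Finset.bipartiteBelow] at h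
  rw [h]
  refine Finset.sum_congr rfl fun a _ => ?_
  rw [← Fintype.card_piFinset]
  congr 1
  ext I
  simp only [Finset.mem_filter, Fintype.mem_piFinset]
  exact ⟨fun h j => ⟨h.1 j, h.2 j⟩, fun h => ⟨fun j => (h j).1, fun j => (h j).2⟩⟩

theorem expectedSize_piFinset (q : ConjunctiveQuery k l)
    (D : ∀ j, Finset (Relation n (q.arity j))) (hD : ∀ j, (D j).Nonempty) (d : Fin l → ℝ)
    (hd : ∀ j t, (((D j).filter fun S => t ∈ S).card : ℝ) = d j * (D j).card) :
    q.expectedSize (Fintype.piFinset D) = (n : ℝ) ^ k * ∏ j, d j := by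
  have hpos : ∀ j, ((D j).card : ℝ) ≠ 0 := fun j => by exact_mod_cast (hD j).card_pos.ne'
  have h := congrArg (Nat.cast : ℕ → ℝ) (q.sum_card_filter_piFinset D fun j t S => t ∈ S)
  push_cast [hd] at h
  rw [expectedSize, Fintype.card_piFinset]
  push_cast
  rw [div_eq_iff (Finset.prod_ne_zero_iff.2 fun j _ => hpos j)]
  refine h.trans ?_
  rw [Finset.prod_mul_distrib]
  simp [mul_assoc]

theorem IsFractionalEdgePacking.le_one {q : ConjunctiveQuery k l} {v : Fin l → ℝ}
    (hv : q.IsFractionalEdgePacking v) (j : Fin l) : v j ≤ 1 :=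
  (Finset.single_le_sum (f := v) (fun j _ => hv.1 j)
    (Finset.mem_filter.2 ⟨Finset.mem_univ j, ⟨0, q.arity_pos j⟩, rfl⟩)).trans
      (hv.2 (q.var j ⟨0, q.arity_pos j⟩))

/-- The weighted form of Friedgut's inequality for a query. -/
theorem IsFractionalEdgePacking.sum_prod_le [NeZero n] {q : ConjunctiveQuery k l} {v : Fin l → ℝ}
    (hv : q.IsFractionalEdgePacking v) (g : ∀ j, (Fin (q.arity j) → Fin n) → ℝ)
    (hg₀ : ∀ j t, 0 ≤ g j t) (d : Fin l → ℝ) (hd : ∀ j, 0 < d j) (hgd : ∀ j t, g j t ≤ d j)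
    (y : Fin l → ℝ) (hy : ∀ j, 0 ≤ y j)
    (hgy : ∀ j, Finset.expect Finset.univ (g j) ≤ d j * y j) :
    ∑ a : Fin k → Fin n, ∏ j, g j (fun i => a (q.var j i)) ≤
      (n : ℝ) ^ k * (∏ j, d j) * ∏ j, y j ^ v j := by
  classical
  -- Interpolation between `g ≤ d` and `g`, with exponent `v j ≤ 1`.
  have hle : ∀ j t, g j t ≤ d j ^ (1 - v j) * g j t ^ v j := by
    intro j t
    rcases (hg₀ j t).eq_or_lt with h | h
    · rw [← h]
      exact mul_nonneg (Real.rpow_nonneg (hd j).le _) (Real.rpow_nonneg le_rfl _)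
    · calc g j t = g j t ^ (1 - v j) * g j t ^ v j := by
            rw [← Real.rpow_add h, sub_add_cancel, Real.rpow_one]
        _ ≤ _ := mul_le_mul_of_nonneg_right
            (Real.rpow_le_rpow h.le (hgd j t) (sub_nonneg.2 (hv.le_one j)))
            (Real.rpow_nonneg h.le _)
  have hfr := expect_prod_rpow_le_of_packing v hv.1 k
    (fun j (a : Fin k → Fin n) => g j fun i => a (q.var j i)) (fun j => Set.range (q.var j))
    (fun j a => hg₀ j _)
    (fun j a b hab => congrArg (g j) (funext fun i => hab _ (Set.mem_range_self i)))
    (fun i => by convert hv.2 i using 2; ext j; simp)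
  simp only [expect_comp_injective _ (q.var_injective _) (g _)] at hfr
  rw [Fintype.expect_eq_sum_div_card, div_le_iff₀ (by exact_mod_cast Fintype.card_pos)] at hfr
  have hcard : ((Fintype.card (Fin k → Fin n) : ℕ) : ℝ) = (n : ℝ) ^ k := by simp
  rw [hcard] at hfr
  calc ∑ a : Fin k → Fin n, ∏ j, g j (fun i => a (q.var j i))
      ≤ ∑ a : Fin k → Fin n, ∏ j, (d j ^ (1 - v j) * g j (fun i => a (q.var j i)) ^ v j) :=
        Finset.sum_le_sum fun a _ => Finset.prod_le_prod (fun j _ => hg₀ j _) fun j _ => hle j _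
    _ = (∏ j, d j ^ (1 - v j)) *
          ∑ a : Fin k → Fin n, ∏ j, g j (fun i => a (q.var j i)) ^ v j := by
        simp only [Finset.prod_mul_distrib, Finset.mul_sum]
    _ ≤ (∏ j, d j ^ (1 - v j)) * ((∏ j, Finset.expect Finset.univ (g j) ^ v j) * (n : ℝ) ^ k) :=
        mul_le_mul_of_nonneg_left hfr
          (Finset.prod_nonneg fun j _ => Real.rpow_nonneg (hd j).le _)
    _ = (n : ℝ) ^ k * ∏ j, (d j ^ (1 - v j) * Finset.expect Finset.univ (g j) ^ v j) := by
        rw [Finset.prod_mul_distrib]; ring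
    _ ≤ (n : ℝ) ^ k * ∏ j, (d j * y j ^ v j) := by
        refine mul_le_mul_of_nonneg_left (Finset.prod_le_prod (fun j _ =>
          mul_nonneg (Real.rpow_nonneg (hd j).le _)
            (Real.rpow_nonneg (Finset.expect_nonneg fun t _ => hg₀ j t) _)) fun j _ => ?_)
          (by positivity)
        calc _ ≤ d j ^ (1 - v j) * (d j * y j) ^ v j :=
              mul_le_mul_of_nonneg_left (Real.rpow_le_rpow
                (Finset.expect_nonneg fun t _ => hg₀ j t) (hgy j) (hv.1 j))
                (Real.rpow_nonneg (hd j).le _)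
          _ = d j * y j ^ v j := by
              rw [Real.mul_rpow (hd j).le (hy j), ← mul_assoc, ← Real.rpow_add (hd j),
                sub_add_cancel, Real.rpow_one]
    _ = _ := by rw [Finset.prod_mul_distrib, mul_assoc]

end ConjunctiveQuery

theorem sum_card_filter_mem_knownElements {α : Type*} [Fintype α] [DecidableEq α]
    (D : Finset (Finset α)) (msg : Finset α → List Bool) :
    ∑ t, (D.filter fun S => t ∈ knownElements D msg S).card =
      ∑ S ∈ D, (knownElements D msg S).card := by
  have h := Finset.sum_card_bipartiteAbove_eq_sum_card_bipartiteBelow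
    (s := (Finset.univ : Finset α)) (t := D) (r := fun t S => t ∈ knownElements D msg S)
  simp only [Finset.bipartiteAbove, Finset.bipartiteBelow] at h
  rw [h]
  simp

/-- A uniformly random set from `D`, on `N` elements, contains every element with probability
`m / N`, and a message of `b` bits about it reveals at most `C * b` elements on average. -/
structure IsHardFamily {α : Type*} [Fintype α] [DecidableEq α] (D : Finset (Finset α)) (m : ℕ)
    (C : ℝ) : Prop where
  nonempty : D.Nonempty
  card_filter_mem : ∀ t, ((D.filter fun S => t ∈ S).card : ℝ) =
    (m : ℝ) / Fintype.card α * D.card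
  sum_card_knownElements_le : ∀ (msg : Finset α → List Bool) (N : ℕ),
    (∀ S ∈ D, (msg S).length ≤ N) →
      (∑ S ∈ D, ((knownElements D msg S).card : ℝ)) / D.card ≤ C * N

namespace ConjunctiveQuery

variable {k l n : ℕ}

/-- The expected number of tuples that one machine outputs. -/
theorem IsFractionalEdgePacking.sum_card_out_le [NeZero n] {q : ConjunctiveQuery k l}
    {v : Fin l → ℝ} (hv : q.IsFractionalEdgePacking v)
    (D : ∀ j, Finset (Relation n (q.arity j))) (m : Fin l → ℕ) (hm : ∀ j, 1 ≤ m j)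
    {C : ℝ} (hC : 0 ≤ C) (hD : ∀ j, IsHardFamily (D j) (m j) C)
    (msg : ∀ j, Relation n (q.arity j) → List Bool)
    (out : (Fin l → List Bool) → Finset (Fin k → Fin n))
    (hout : ∀ I ∈ Fintype.piFinset D, out (fun j => msg j (I j)) ⊆ q.eval I)
    (X : ℝ) (hX₀ : 0 ≤ X) (hX : ∀ j, ∀ S ∈ D j, ((msg j S).length : ℝ) ≤ X) :
    (∑ I ∈ Fintype.piFinset D, ((out fun j => msg j (I j)).card : ℝ)) /
        (Fintype.piFinset D).card ≤
      q.expectedSize (Fintype.piFinset D) * ∏ j, (C * X / m j) ^ v j := by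
  classical
  have hn : (0 : ℝ) < n := by exact_mod_cast Nat.pos_of_ne_zero (NeZero.ne n)
  have hDpos : ∀ j, (0 : ℝ) < (D j).card := fun j => by
    exact_mod_cast (hD j).nonempty.card_pos
  have hmpos : ∀ j, (0 : ℝ) < m j := fun j => by exact_mod_cast hm j
  have hcpos : ∀ j, (0 : ℝ) < Fintype.card (Fin (q.arity j) → Fin n) := fun j => by
    exact_mod_cast Fintype.card_pos
  set g : ∀ j, (Fin (q.arity j) → Fin n) → ℝ := fun j t =>
    ((D j).filter fun S => t ∈ knownElements (D j) (msg j) S).card / (D j).card with hg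
  have hknown : ∀ I ∈ Fintype.piFinset D, out (fun j => msg j (I j)) ⊆
      Finset.univ.filter fun a : Fin k → Fin n =>
        ∀ j, (fun i => a (q.var j i)) ∈ knownElements (D j) (msg j) (I j) := by
    intro I hI a ha
    refine Finset.mem_filter.2 ⟨Finset.mem_univ _, fun j =>
      Finset.mem_filter.2 ⟨Finset.mem_univ _, fun S hS hmsg => ?_⟩⟩
    -- The product structure is used here: one relation can be exchanged alone.
    have hI' : Function.update I j S ∈ Fintype.piFinset D := Fintype.mem_piFinset.2 fun j' => by
      rcases eq_or_ne j' j with rfl | h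
      · rwa [Function.update_self]
      · rw [Function.update_of_ne h]; exact Fintype.mem_piFinset.1 hI j'
    have hsame : (fun j' => msg j' (Function.update I j S j')) = fun j' => msg j' (I j') :=
      funext fun j' => by
        rcases eq_or_ne j' j with rfl | h
        · rwa [Function.update_self]
        · rw [Function.update_of_ne h]
    have := (Finset.mem_filter.1 (hout _ hI' (hsame ▸ ha))).2 j
    rwa [Function.update_self] at this
  have hsum : (∑ I ∈ Fintype.piFinset D, ((out fun j => msg j (I j)).card : ℝ)) /
      (Fintype.piFinset D).card ≤ ∑ a : Fin k → Fin n, ∏ j, g j (fun i => a (q.var j i)) := by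
    have h := (Finset.sum_le_sum fun I hI => Finset.card_le_card (hknown I hI)).trans_eq
      (q.sum_card_filter_piFinset D fun j t S => t ∈ knownElements (D j) (msg j) S)
    have h' := (Nat.cast_le (α := ℝ)).2 h
    push_cast at h'
    rw [Fintype.card_piFinset]
    push_cast
    refine (div_le_div_of_nonneg_right h' (Finset.prod_nonneg fun j _ => (hDpos j).le)).trans_eq ?_
    rw [Finset.sum_div]
    exact Finset.sum_congr rfl fun a _ => (Finset.prod_div_distrib _ _).symm
  rw [q.expectedSize_piFinset D (fun j => (hD j).nonempty) _ fun j => (hD j).card_filter_mem]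
  refine hsum.trans (hv.sum_prod_le g (fun j t => by positivity) _
    (fun j => div_pos (hmpos j) (hcpos j)) (fun j t => ?_) _
    (fun j => div_nonneg (mul_nonneg hC hX₀) (hmpos j).le) fun j => ?_)
  · rw [hg, div_le_iff₀ (hDpos j), ← (hD j).card_filter_mem t]
    refine Nat.cast_le.2 (Finset.card_le_card fun S hS => ?_)
    obtain ⟨hS, ht⟩ := Finset.mem_filter.1 hS
    exact Finset.mem_filter.2 ⟨hS, (Finset.mem_filter.1 ht).2 S hS rfl⟩
  -- Message lengths are integers, so the real bound `X` may be rounded down.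
  · have hN := (hD j).sum_card_knownElements_le (msg j) ⌊X⌋₊
      fun S hS => Nat.le_floor (hX j S hS)
    have hN' := hN.trans (mul_le_mul_of_nonneg_left (Nat.floor_le hX₀) hC)
    have hs := congrArg (Nat.cast : ℕ → ℝ) (sum_card_filter_mem_knownElements (D j) (msg j))
    push_cast at hs
    simp only [hg]
    rw [Fintype.expect_eq_sum_div_card, ← Finset.sum_div, hs, div_mul_div_comm,
      mul_comm (m j : ℝ), mul_div_mul_right _ _ (hmpos j).ne']
    gcongr

end ConjunctiveQuery

/-! ### All machines -/

/-- Any `S ∈ D j` occurs in some database of the product, so the bound on the total bits bounds each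
single message. -/
theorem length_msg_le {k l n p : ℕ} {q : ConjunctiveQuery k l} {Ω : Type u}
    (A : OneRoundAlgorithm q n p Ω) (D : ∀ j, Finset (Relation n (q.arity j)))
    (hD : ∀ j, (D j).Nonempty) (ω : Ω) (c : Fin p) (X : ℝ)
    (hX : ∀ I ∈ Fintype.piFinset D, (A.bitsReceived ω I c : ℝ) ≤ X) (j : Fin l)
    (S : Relation n (q.arity j)) (hS : S ∈ D j) : ((A.msg ω c j S).length : ℝ) ≤ X := by
  classical
  choose I₀ hI₀ using hD
  have hI : Function.update I₀ j S ∈ Fintype.piFinset D := Fintype.mem_piFinset.2 fun j' => by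
    rcases eq_or_ne j' j with rfl | h
    · rwa [Function.update_self]
    · rw [Function.update_of_ne h]; exact hI₀ j'
  refine le_trans (Nat.cast_le.2 ?_) (hX _ hI)
  have := Finset.single_le_sum
    (f := fun j' => (A.msg ω c j' (Function.update I₀ j S j')).length)
    (fun _ _ => Nat.zero_le _) (Finset.mem_univ j)
  rw [Function.update_self] at this
  exact this

theorem oneRoundLoadAtLeast_of_isHardFamily {k l n p : ℕ} [NeZero n] (q : ConjunctiveQuery k l)
    (D : ∀ j, Finset (Relation n (q.arity j))) (m : Fin l → ℕ) (hm : ∀ j, 1 ≤ m j)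
    {C : ℝ} (hC : 0 < C) (hD : ∀ j, IsHardFamily (D j) (m j) C) (w : Fin p → ℝ)
    (hw : ∀ c, 0 ≤ w c) (v : Fin p → Fin l → ℝ) (hv : ∀ c, q.IsFractionalEdgePacking (v c))
    (L : ℝ) (hL : IsLeast (admissibleLoads m w v) L) :
    OneRoundLoadAtLeast.{u} q (Fintype.piFinset D) w (C⁻¹ * L) := by
  intro Ω _ P _ A hsound hexp
  by_contra! hlt
  set E := q.expectedSize (Fintype.piFinset D) with hE
  have hEpos : 0 < E := by
    rw [hE, q.expectedSize_piFinset D (fun j => (hD j).nonempty) _ fun j => (hD j).card_filter_mem]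
    have hn : (0 : ℝ) < n := by exact_mod_cast Nat.pos_of_ne_zero (NeZero.ne n)
    refine mul_pos (pow_pos hn k) (Finset.prod_pos fun j _ => div_pos ?_ ?_)
    · exact_mod_cast hm j
    · exact_mod_cast Fintype.card_pos
  obtain ⟨B, hB⟩ : ∃ B, (A.load w (Fintype.piFinset D)).toReal = B := ⟨_, rfl⟩
  have hB₀ : 0 ≤ B := hB ▸ ENNReal.toReal_nonneg
  have hBL : B < C⁻¹ * L := hB ▸ ENNReal.toReal_lt_of_lt_ofReal hlt
  have hbits : ∀ ω c, ∀ I ∈ Fintype.piFinset D, (A.bitsReceived ω I c : ℝ) ≤ B * w c := by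
    intro ω c I hI
    have h1 : (A.bitsReceived ω I c : ℝ≥0∞) / ENNReal.ofReal (w c) ≤
        A.load w (Fintype.piFinset D) :=
      le_iSup_of_le ω (le_iSup₂_of_le I hI (le_iSup_of_le c le_rfl))
    rw [← ENNReal.ofReal_toReal hlt.ne_top, hB] at h1
    -- This includes `w c = 0`: the load is finite, so such a machine receives nothing.
    have h2 : (A.bitsReceived ω I c : ℝ≥0∞) ≤ ENNReal.ofReal B * ENNReal.ofReal (w c) := by
      rwa [ENNReal.div_le_iff_le_mul (Or.inr ENNReal.ofReal_ne_top)
        (Or.inl ENNReal.ofReal_ne_top)] at h1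
    rw [← ENNReal.ofReal_mul hB₀, ← ENNReal.ofReal_natCast] at h2
    exact (ENNReal.ofReal_le_ofReal_iff (mul_nonneg hB₀ (hw c))).1 h2
  set F := ∑ c, ∏ j, (C * B * w c / m j) ^ v c j with hF
  have hFlt : F < 1 := by
    by_contra! h
    have := hL.2 (show C * B ∈ admissibleLoads m w v from ⟨mul_nonneg hC.le hB₀, h⟩)
    rw [inv_mul_eq_div, lt_div_iff₀' hC] at hBL
    exact absurd this (not_le.2 hBL)
  have hseed : ∀ ω, (∑ I ∈ Fintype.piFinset D, ((A.output ω I).card : ℝ)) /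
      (Fintype.piFinset D).card ≤ E * F := by
    intro ω
    calc _ ≤ (∑ I ∈ Fintype.piFinset D, ∑ c,
            ((A.out ω c fun j => A.msg ω c j (I j)).card : ℝ)) / (Fintype.piFinset D).card := by
          gcongr with I hI
          exact_mod_cast Finset.card_biUnion_le
      _ = ∑ c, (∑ I ∈ Fintype.piFinset D,
            ((A.out ω c fun j => A.msg ω c j (I j)).card : ℝ)) / (Fintype.piFinset D).card := by
          rw [Finset.sum_comm, Finset.sum_div]
      _ ≤ ∑ c, E * ∏ j, (C * (B * w c) / m j) ^ v c j := by
          refine Finset.sum_le_sum fun c _ => (hv c).sum_card_out_le D m hm hC.le hD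
            (A.msg ω c) (A.out ω c) (fun I hI => ?_) _ (mul_nonneg hB₀ (hw c))
            (length_msg_le A D (fun j => (hD j).nonempty) ω c _ (hbits ω c))
          exact (Finset.subset_biUnion_of_mem
            (fun c => A.out ω c fun j => A.msg ω c j (I j)) (Finset.mem_univ c)).trans
              (hsound ω I hI)
      _ = E * F := by simp only [hF, Finset.mul_sum, mul_assoc]
  have hint : A.expectedOutput P (Fintype.piFinset D) ≤ E * F := by
    -- No measurability in the seed is needed: a non-integrable function has integral `0`.
    refine (MeasureTheory.integral_mono_of_nonneg (g := fun _ => E * F)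
      (Filter.Eventually.of_forall fun ω => ?_) (MeasureTheory.integrable_const _)
      (Filter.Eventually.of_forall hseed)).trans_eq (by simp)
    exact div_nonneg (Finset.sum_nonneg fun _ _ => Nat.cast_nonneg _) (Nat.cast_nonneg _)
  exact absurd (hexp.trans hint) (not_le.2 (mul_lt_of_lt_one_right hEpos hFlt))

/-! ### The least admissible load -/

/-- Nonnegative exponents make the sum continuous in `L`, also where a base is `0`, so the set is
closed. It is nonempty: `L = (∑ m j) / w c` makes every base of machine `c` at least `1`. -/
theorem exists_isLeast_admissibleLoads {l p : ℕ} (m : Fin l → ℕ) (hm : ∀ j, 1 ≤ m j)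
    (w : Fin p → ℝ) (hw : ∀ c, 0 ≤ w c) (hw' : ∃ c, 0 < w c) (v : Fin p → Fin l → ℝ)
    (hv : ∀ c j, 0 ≤ v c j) : ∃ L, IsLeast (admissibleLoads m w v) L := by
  have hmpos : ∀ j, (0 : ℝ) < m j := fun j => by exact_mod_cast hm j
  have hcont : Continuous fun L : ℝ => ∑ c, ∏ j, (L * w c / (m j : ℝ)) ^ (v c j) :=
    continuous_finsetSum _ fun c _ => continuous_finsetProd _ fun j _ =>
      Continuous.rpow_const (by fun_prop) fun _ => Or.inr (hv c j)
  have hclosed : IsClosed (admissibleLoads m w v) :=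
    (isClosed_le continuous_const continuous_id).inter (isClosed_le continuous_const hcont)
  have hbdd : BddBelow (admissibleLoads m w v) := ⟨0, fun L hL => hL.1⟩
  obtain ⟨c, hc⟩ := hw'
  have hL₀ : 0 ≤ (∑ j, (m j : ℝ)) / w c :=
    div_nonneg (Finset.sum_nonneg fun j _ => (hmpos j).le) hc.le
  refine ⟨_, hclosed.isLeast_csInf ⟨(∑ j, (m j : ℝ)) / w c, hL₀, ?_⟩ hbdd⟩
  refine le_trans ?_ (Finset.single_le_sum (f := fun c' => ∏ j,
    ((∑ j, (m j : ℝ)) / w c * w c' / (m j : ℝ)) ^ (v c' j)) (fun c' _ => ?_) (Finset.mem_univ c))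
  · refine Finset.one_le_prod fun j _ => Real.one_le_rpow ?_ (hv c j)
    rw [div_mul_cancel₀ _ hc.ne', one_le_div (hmpos j)]
    exact Finset.single_le_sum (f := fun j => (m j : ℝ)) (fun j _ => (hmpos j).le)
      (Finset.mem_univ j)
  · exact Finset.prod_nonneg fun j _ => Real.rpow_nonneg
      (div_nonneg (mul_nonneg hL₀ (hw c')) (hmpos j).le) _

/-! ### The two distributions -/

theorem IsHardFamily.of_card_filter_subset_le {α : Type*} [Fintype α] [DecidableEq α]
    [Nonempty α] {D : Finset (Finset α)} (hD : D.Nonempty) {m : ℕ}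
    (hmem : ∀ t, Fintype.card α * (D.filter fun S => t ∈ S).card = m * D.card)
    {θ ρ : ℝ} (hθ₀ : 0 ≤ θ) (hθρ : θ ≤ ρ) (hρ₀ : 0 < ρ) (hρ₁ : ρ < 1)
    (hsub : ∀ K : Finset α, ((D.filter fun S => K ⊆ S).card : ℝ) ≤ θ ^ K.card * D.card) :
    IsHardFamily D m (Real.log 4 / -Real.log ρ) where
  nonempty := hD
  card_filter_mem t := by
    have h := congrArg (Nat.cast : ℕ → ℝ) (hmem t)
    push_cast at h
    rw [div_mul_eq_mul_div, eq_div_iff (by exact_mod_cast Fintype.card_ne_zero), mul_comm]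
    exact h
  sum_card_knownElements_le := _root_.sum_card_knownElements_le D hD ρ hρ₀ hρ₁ fun K =>
    (hsub K).trans (by gcongr)

theorem isHardFamily_powersetCard {α : Type*} [Fintype α] [DecidableEq α] [Nonempty α] {m : ℕ}
    {θ ρ : ℝ} (hθ₀ : 0 ≤ θ) (hθρ : θ ≤ ρ) (hρ₀ : 0 < ρ) (hρ₁ : ρ < 1)
    (hm : (m : ℝ) ≤ θ * Fintype.card α) :
    IsHardFamily (Finset.univ.powersetCard m : Finset (Finset α)) m
      (Real.log 4 / -Real.log ρ) := by
  have hmN : m ≤ Fintype.card α := by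
    have : (m : ℝ) ≤ Fintype.card α :=
      hm.trans (mul_le_of_le_one_left (Nat.cast_nonneg _) (hθρ.trans hρ₁.le))
    exact_mod_cast this
  refine .of_card_filter_subset_le (Finset.powersetCard_nonempty.2 hmN) (fun t => ?_) hθ₀ hθρ
    hρ₀ hρ₁ (card_filter_subset_powersetCard_le m θ hθ₀ (hθρ.trans hρ₁.le) hm)
  simpa using card_mul_card_filter_insert_subset_powersetCard m ∅ t (Finset.notMem_empty t)

theorem isHardFamily_matchings {n r m : ℕ} (hn : 2 ≤ n) (hr : 0 < r) (hm : m ≤ n) {θ ρ : ℝ}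
    (hθ₀ : 0 ≤ θ) (hθρ : θ ≤ ρ) (hρ : 3 / 4 ≤ ρ) (hρ₁ : ρ < 1)
    (hmθ : r = 1 → (m : ℝ) ≤ θ * n) :
    IsHardFamily (matchings n r m) m (Real.log 4 / -Real.log ρ) := by
  have : NeZero n := ⟨by omega⟩
  have hmem : ∀ t, Fintype.card (Fin r → Fin n) *
      ((matchings n r m).filter fun S => t ∈ S).card = m * (matchings n r m).card := by
    intro t
    simpa using pow_mul_card_filter_insert_subset_matchings hr m ∅ (by simp [Relation.IsMatching])
      t (by simp)
  have hρ₀ : 0 < ρ := by linarith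
  rcases eq_or_ne r 1 with rfl | h
  · exact .of_card_filter_subset_le (matchings_nonempty hr hm) hmem hθ₀ hθρ hρ₀ hρ₁
      (card_filter_subset_matchings_le_of_arity_one θ hθ₀ (hθρ.trans hρ₁.le) (hmθ rfl))
  · exact .of_card_filter_subset_le (matchings_nonempty hr hm) hmem (by norm_num) hρ hρ₀ hρ₁
      (card_filter_subset_matchings_le hn (by omega) hm)

namespace ConjunctiveQuery

variable {k l : ℕ}

theorem instances_eq_piFinset (q : ConjunctiveQuery k l) (n : ℕ) (m : Fin l → ℕ) :
    q.instances n m = Fintype.piFinset fun j => Finset.univ.powersetCard (m j) := by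
  ext I
  simp [instances, Fintype.mem_piFinset, Finset.mem_powersetCard]

theorem matchingInstances_eq_piFinset (q : ConjunctiveQuery k l) (n : ℕ) (m : Fin l → ℕ) :
    q.matchingInstances n m = Fintype.piFinset fun j => matchings n (q.arity j) (m j) := by
  ext I
  simp [matchingInstances, Fintype.mem_piFinset, mem_matchings]

end ConjunctiveQuery

theorem mainTheorem9 (θ : ℝ) (hθ₀ : 0 < θ) (hθ₁ : θ < 1) :
    ∃ κ : ℝ, 0 < κ ∧
      ∀ (k l n p : ℕ) (q : ConjunctiveQuery k l) (m : Fin l → ℕ) (w : Fin p → ℝ)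
        (v : Fin p → Fin l → ℝ),
        2 ≤ n → (∀ j, 1 ≤ m j) → (∀ c, 0 ≤ w c) → (∃ c, 0 < w c) →
        (∀ c, q.IsFractionalEdgePacking (v c)) →
        ∃ L : ℝ, IsLeast (admissibleLoads m w v) L ∧
          ((∀ j, m j ≤ n ∧ (q.arity j = 1 → (m j : ℝ) ≤ θ * n)) →
            OneRoundLoadAtLeast.{u} q (q.matchingInstances n m) w (κ * L)) ∧
          ((∀ j, (m j : ℝ) = θ * (n : ℝ) ^ q.arity j) →
            OneRoundLoadAtLeast.{u} q (q.instances n m) w (κ * L)) := by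
  -- One `ρ` for all cases: `θ` serves dense and unary relations, `3 / 4` matchings of arity at
  -- least two. Thus `κ` depends on `θ` alone.
  obtain ⟨ρ, hθρ, hρ, hρ₁⟩ : ∃ ρ : ℝ, θ ≤ ρ ∧ 3 / 4 ≤ ρ ∧ ρ < 1 :=
    ⟨max θ (3 / 4), le_max_left _ _, le_max_right _ _, max_lt hθ₁ (by norm_num)⟩
  have hρ₀ : 0 < ρ := hθ₀.trans_le hθρ
  have hC : 0 < Real.log 4 / -Real.log ρ :=
    div_pos (Real.log_pos (by norm_num)) (neg_pos.2 (Real.log_neg hρ₀ hρ₁))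
  refine ⟨_, inv_pos.2 hC, ?_⟩
  intro k l n p q m w v hn hm hw hw' hv
  have : NeZero n := ⟨by omega⟩
  obtain ⟨L, hL⟩ := exists_isLeast_admissibleLoads m hm w hw hw' v fun c => (hv c).1
  refine ⟨L, hL, fun h => ?_, fun h => ?_⟩
  · rw [q.matchingInstances_eq_piFinset]
    exact oneRoundLoadAtLeast_of_isHardFamily q _ m hm hC (fun j =>
      isHardFamily_matchings hn (q.arity_pos j) (h j).1 hθ₀.le hθρ hρ hρ₁ (h j).2) w hw v hv L hL
  · rw [q.instances_eq_piFinset]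
    exact oneRoundLoadAtLeast_of_isHardFamily q _ m hm hC (fun j =>
      isHardFamily_powersetCard hθ₀.le hθρ hρ₀ hρ₁ (by simp [h j])) w hw v hv L hL
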